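/- Let $(M_n,Q_n)_{n\ge 1}$ be a sequence of i.i.d. $\mathbb{R}^2$-valued random vectors with generic copy $(M,Q)$. Put $\Pi_0:=1$, $\Pi_n:=M_1M_2\cdots M_n$ and $Z_n:=\sum_{k=1}^n \Pi_{k-1}Q_k$ for $n\ge 1$, let $Z_\infty:=\lim_{n\to\infty}Z_n=\sum_{k\ge 1}\Pi_{k-1}Q_k$ whenever this limit exists almost surely and is finite, and let $Z_\infty^*:=\sum_{n\ge 1}|\Pi_{n-1}Q_n|\in[0,\infty]$. Assume that $\mathbb{P}\{M=0\}=0$, that $\mathbb{P}\{Q=0\}<1$, and that $\mathbb{P}\{Q+Mc=c\}<1$ for all $c\in\mathbb{R}$. Then for every real $p>0$ the following assertions are equivalent: 1. $\mathbb{E}|M|^p<1$ and $\mathbb{E}|Q|^p<\infty$; 2. $\mathbb{E}|Z_\infty|^p<\infty$, that is, $(Z_n)_{n\ge 1}$ converges almost surely to a finite limit $Z_\infty$ and $\mathbb{E}|Z_\infty|^p<\infty$; 3. $\mathbb{E}(Z_\infty^*)^p<\infty$. -/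

import Mathlib

open MeasureTheory ProbabilityTheory Filter Topology
open scoped ENNReal

namespace Perpetuity

variable {Ω : Type*}

/-- The product of the first `n` multipliers. The sequences are indexed from `0`, so this is
`M 0 ω * ⋯ * M (n - 1) ω`, and it equals `1` for `n = 0`. -/
noncomputable def prodM (M : ℕ → Ω → ℝ) (n : ℕ) (ω : Ω) : ℝ :=
  ∏ i ∈ Finset.range n, M i ω

/-- The `n`-th partial sum `Z_n` of the perpetuity series. -/
noncomputable def partialSum (M Q : ℕ → Ω → ℝ) (n : ℕ) (ω : Ω) : ℝ :=
  ∑ k ∈ Finset.range n, prodM M k ω * Q k ω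

/-- `Z` is (a version of) the perpetuity `Z_∞`: the partial sums converge almost surely to the
finite limit `Z`. -/
def IsPerpetuity [MeasurableSpace Ω] (μ : Measure Ω) (M Q : ℕ → Ω → ℝ) (Z : Ω → ℝ) : Prop :=
  ∀ᵐ ω ∂μ, Tendsto (fun n => partialSum M Q n ω) atTop (𝓝 (Z ω))

/-- The series of absolute values, with value `∞` where it diverges. -/
noncomputable def absSeries (M Q : ℕ → Ω → ℝ) (ω : Ω) : ℝ≥0∞ :=
  ∑' n, ‖prodM M n ω * Q n ω‖ₑ

end Perpetuity

namespace Perpetuity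

/-! ### Splitting the series at time `n`. -/

section Deterministic

variable {Ω : Type*} {M Q : ℕ → Ω → ℝ}

/-! Contraction gives moments: independence makes the `p`-th moments of the terms decay
geometrically, which `tsum_rpow_le_weighted` turns into a bound on the absolute series, for every `p
> 0` alike. Absolute convergence then gives `Z`.

The converse rests on Z = Z_n + Π_n W_n, where W_n is independent of (Z_n, Π_n) and has the law κ of
Z. So κ is invariant under each random affine map z ↦ Z_n + Π_n z, and `hdeg` prevents it from being
a point mass. As Π_n W_n = Z - Z_n → 0 with W_n independent and not a.s. zero, Π_n → 0 in
probability. Comparing the map at two independent points of law κ eliminates Z_n and bounds the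
truncated `p`-th moments of Π_n by tails of κ, uniformly in `n` (`setLIntegral_slope_mul_le`). Hence
E|Π_n|^p = (E|M|^p)^n < 1 for some `n`, so E|M|^p < 1. Invariance for n = 1 then yields the moment
of Q. -/

lemma prodM_add (M : ℕ → Ω → ℝ) (n k : ℕ) (ω : Ω) :
    prodM M (n + k) ω = prodM M n ω * prodM (fun j => M (n + j)) k ω :=
  Finset.prod_range_add _ _ _

lemma partialSum_add (M Q : ℕ → Ω → ℝ) (n k : ℕ) (ω : Ω) :
    partialSum M Q (n + k) ω = partialSum M Q n ω +
      prodM M n ω * partialSum (fun j => M (n + j)) (fun j => Q (n + j)) k ω := by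
  simp only [partialSum, Finset.sum_range_add, Finset.mul_sum, prodM_add, mul_assoc]

variable [MeasurableSpace Ω]

lemma measurable_prodM {n : ℕ} (hM : ∀ i < n, Measurable (M i)) : Measurable (prodM M n) := by
  unfold prodM
  exact Finset.measurable_prod _ fun i hi => hM i (Finset.mem_range.1 hi)

lemma measurable_partialSum {n : ℕ} (hM : ∀ i < n, Measurable (M i))
    (hQ : ∀ i < n, Measurable (Q i)) : Measurable (partialSum M Q n) := by
  unfold partialSum
  refine Finset.measurable_sum _ fun i hi => ?_
  have hi := Finset.mem_range.1 hi
  exact (measurable_prodM fun j hj => hM j (hj.trans hi)).mul (hQ i hi)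

end Deterministic

/-! ### Powers of series. -/

section SeriesBound

/-- A power of a series is controlled by a geometrically weighted series of powers. -/
lemma tsum_rpow_le_weighted {p : ℝ} (hp : 0 < p) {t : ℝ≥0∞} (ht0 : t ≠ 0) (ht : t ≠ ∞)
    (a : ℕ → ℝ≥0∞) :
    (∑' n, a n) ^ p ≤ ((1 - t ^ p⁻¹)⁻¹) ^ p * ∑' n, a n ^ p * (t⁻¹) ^ n := by
  set B := ∑' n, a n ^ p * (t⁻¹) ^ n with hB
  -- Each term of `B` is at most `B`, so the `a n` lie below a geometric sequence; no split at p = 1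
  -- is needed.
  have h1 : ∀ n, a n ≤ B ^ p⁻¹ * (t ^ p⁻¹) ^ n := by
    intro n
    have h2 : a n ^ p ≤ B * t ^ n := by
      calc a n ^ p = a n ^ p * (t⁻¹) ^ n * t ^ n := by
            rw [mul_assoc, ← mul_pow, ENNReal.inv_mul_cancel ht0 ht, one_pow, mul_one]
        _ ≤ B * t ^ n := by
            gcongr
            exact ENNReal.le_tsum (f := fun n => a n ^ p * (t⁻¹) ^ n) n
    calc a n = (a n ^ p) ^ p⁻¹ := by rw [ENNReal.rpow_rpow_inv hp.ne']
      _ ≤ (B * t ^ n) ^ p⁻¹ := ENNReal.rpow_le_rpow h2 (by positivity)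
      _ = B ^ p⁻¹ * (t ^ p⁻¹) ^ n := by
          rw [ENNReal.mul_rpow_of_nonneg _ _ (by positivity), ← ENNReal.rpow_natCast,
            ← ENNReal.rpow_natCast, ← ENNReal.rpow_mul, ← ENNReal.rpow_mul, mul_comm (n : ℝ)]
  calc (∑' n, a n) ^ p ≤ (∑' n, B ^ p⁻¹ * (t ^ p⁻¹) ^ n) ^ p :=
        ENNReal.rpow_le_rpow (ENNReal.tsum_le_tsum h1) hp.le
    _ = _ := by
        rw [ENNReal.tsum_mul_left, ENNReal.tsum_geometric,
          ENNReal.mul_rpow_of_nonneg _ _ hp.le, ENNReal.rpow_inv_rpow hp.ne', mul_comm]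

end SeriesBound

/-! ### Laws invariant under a random affine map. -/

section RandomAffineFixedPoint

variable {Ω : Type*} [MeasurableSpace Ω] {μ : Measure Ω} {κ : Measure ℝ} {X Y : Ω → ℝ} {p : ℝ}

lemma lintegral_eq_of_map_affine [SFinite κ] (hX : Measurable X) (hY : Measurable Y)
    (hfix : (μ.prod κ).map (fun q => X q.1 + Y q.1 * q.2) = κ)
    {g : ℝ → ℝ≥0∞} (hg : Measurable g) :
    ∫⁻ ω, ∫⁻ z, g (X ω + Y ω * z) ∂κ ∂μ = ∫⁻ z, g z ∂κ := by
  have hm : Measurable fun q : Ω × ℝ => X q.1 + Y q.1 * q.2 := by fun_prop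
  conv_rhs => rw [← hfix, lintegral_map hg hm]
  exact (lintegral_prod (fun q : Ω × ℝ => g (X q.1 + Y q.1 * q.2))
    (hg.comp hm).aemeasurable).symm

/-- The difference of the two values is y(z - w), free of x, so the larger value has norm at least
δ‖y‖/2 ≥ K and survives the truncation. -/
lemma enorm_rpow_mul_le (hp : 0 < p) {K δ : ℝ≥0∞} {x y z w : ℝ}
    (hK : 2 * K ≤ δ * ‖y‖ₑ) (hδ : δ ≤ ‖z - w‖ₑ) :
    ‖y‖ₑ ^ p * δ ^ p ≤ 2 ^ p *
      ({z : ℝ | K ≤ ‖z‖ₑ}.indicator (fun z => ‖z‖ₑ ^ p) (x + y * z) +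
        {z : ℝ | K ≤ ‖z‖ₑ}.indicator (fun z => ‖z‖ₑ ^ p) (x + y * w)) := by
  have main : ∀ u v : ℝ, δ ≤ ‖u - v‖ₑ → ‖x + y * v‖ₑ ≤ ‖x + y * u‖ₑ → ‖y‖ₑ ^ p * δ ^ p ≤ 2 ^ p *
      {z : ℝ | K ≤ ‖z‖ₑ}.indicator (fun z => ‖z‖ₑ ^ p) (x + y * u) := by
    intro u v huv hle
    have h1 : δ * ‖y‖ₑ ≤ 2 * ‖x + y * u‖ₑ := by
      calc δ * ‖y‖ₑ ≤ ‖u - v‖ₑ * ‖y‖ₑ := by gcongr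
        _ = ‖(x + y * u) - (x + y * v)‖ₑ := by rw [← enorm_mul]; congr 1; ring
        _ ≤ ‖x + y * u‖ₑ + ‖x + y * v‖ₑ := enorm_sub_le
        _ ≤ 2 * ‖x + y * u‖ₑ := by rw [two_mul]; gcongr
    have h2 : K ≤ ‖x + y * u‖ₑ :=
      (ENNReal.mul_le_mul_iff_right (by simp) (by simp)).1 (hK.trans h1)
    rw [Set.indicator_of_mem (by exact h2), ← ENNReal.mul_rpow_of_nonneg _ _ hp.le,
      ← ENNReal.mul_rpow_of_nonneg _ _ hp.le, mul_comm]
    exact ENNReal.rpow_le_rpow h1 hp.le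
  rcases le_total ‖x + y * w‖ₑ ‖x + y * z‖ₑ with h | h
  · refine (main z w hδ h).trans ?_
    gcongr
    exact le_self_add
  · have h' : δ ≤ ‖w - z‖ₑ := by rwa [← enorm_neg, neg_sub]
    refine (main w z h' h).trans ?_
    gcongr
    exact le_add_self

/-- The truncated moments of the slope of a random affine map are controlled by those of any
invariant law. -/
lemma setLIntegral_slope_mul_le [IsProbabilityMeasure κ] (hp : 0 < p)
    (hX : Measurable X) (hY : Measurable Y)
    (hfix : (μ.prod κ).map (fun q => X q.1 + Y q.1 * q.2) = κ) (K δ : ℝ≥0∞) :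
    (∫⁻ ω in {ω | 2 * K ≤ δ * ‖Y ω‖ₑ}, ‖Y ω‖ₑ ^ p ∂μ) *
      (δ ^ p * (κ.prod κ) {q | δ ≤ ‖q.1 - q.2‖ₑ}) ≤
      2 ^ p * (2 * ∫⁻ z in {z | K ≤ ‖z‖ₑ}, ‖z‖ₑ ^ p ∂κ) := by
  set S : Set Ω := {ω | 2 * K ≤ δ * ‖Y ω‖ₑ}
  have hS : MeasurableSet S := measurableSet_le (by fun_prop) (by fun_prop)
  set D : Set (ℝ × ℝ) := {q | δ ≤ ‖q.1 - q.2‖ₑ}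
  have hD : MeasurableSet D := measurableSet_le (by fun_prop) (by fun_prop)
  have hA : MeasurableSet {z : ℝ | K ≤ ‖z‖ₑ} := measurableSet_le (by fun_prop) (by fun_prop)
  set g : ℝ → ℝ≥0∞ := {z : ℝ | K ≤ ‖z‖ₑ}.indicator (fun z => ‖z‖ₑ ^ p) with hg_def
  have hg : Measurable g := Measurable.indicator (by fun_prop) hA
  have hinner : ∀ ω, ∫⁻ q, 2 ^ p * (g (X ω + Y ω * q.1) + g (X ω + Y ω * q.2)) ∂(κ.prod κ) =
      2 ^ p * (2 * ∫⁻ z, g (X ω + Y ω * z) ∂κ) := by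
    intro ω
    have hgω : Measurable fun z : ℝ => g (X ω + Y ω * z) := hg.comp (by fun_prop)
    have h1 : Measurable fun q : ℝ × ℝ => g (X ω + Y ω * q.1) := hgω.comp measurable_fst
    have h2 : Measurable fun q : ℝ × ℝ => g (X ω + Y ω * q.2) := hgω.comp measurable_snd
    have h12 : Measurable fun q : ℝ × ℝ => g (X ω + Y ω * q.1) + g (X ω + Y ω * q.2) := h1.add h2
    rw [lintegral_const_mul _ h12, lintegral_add_left h1,
      measurePreserving_fst.lintegral_comp hgω, measurePreserving_snd.lintegral_comp hgω, two_mul]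
  have hgm : Measurable fun ω => ∫⁻ z, g (X ω + Y ω * z) ∂κ :=
    Measurable.lintegral_prod_right' (f := fun q : Ω × ℝ => g (X q.1 + Y q.1 * q.2))
      (hg.comp (by fun_prop))
  have hDm : Measurable fun q : ℝ × ℝ => D.indicator (fun _ => δ ^ p) q :=
    measurable_const.indicator hD
  calc (∫⁻ ω in S, ‖Y ω‖ₑ ^ p ∂μ) * (δ ^ p * (κ.prod κ) D)
      = ∫⁻ ω, ∫⁻ q, S.indicator (fun ω => ‖Y ω‖ₑ ^ p) ω * D.indicator (fun _ => δ ^ p) q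
          ∂(κ.prod κ) ∂μ := by
        simp_rw [lintegral_const_mul _ hDm]
        rw [lintegral_mul_const _ (Measurable.indicator (by fun_prop) hS),
          lintegral_indicator hS, lintegral_indicator hD, setLIntegral_const]
    _ ≤ ∫⁻ ω, ∫⁻ q, 2 ^ p * (g (X ω + Y ω * q.1) + g (X ω + Y ω * q.2)) ∂(κ.prod κ) ∂μ := by
        refine lintegral_mono fun ω => lintegral_mono fun q => ?_
        by_cases hω : ω ∈ S
        · by_cases hq : q ∈ D
          · simp only [Set.indicator_of_mem hω, Set.indicator_of_mem hq]
            exact enorm_rpow_mul_le hp hω hq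
          · simp [hq]
        · simp [hω]
    _ = 2 ^ p * (2 * ∫⁻ z in {z | K ≤ ‖z‖ₑ}, ‖z‖ₑ ^ p ∂κ) := by
        simp_rw [hinner]
        rw [lintegral_const_mul _ (hgm.const_mul _), lintegral_const_mul _ hgm,
          lintegral_eq_of_map_affine hX hY hfix hg, hg_def, lintegral_indicator hA]

lemma tendsto_setLIntegral_enorm_rpow_tail [IsFiniteMeasure κ]
    (hκ : ∫⁻ z, ‖z‖ₑ ^ p ∂κ < ∞) :
    Tendsto (fun k : ℕ => ∫⁻ z in {z : ℝ | (k : ℝ≥0∞) ≤ ‖z‖ₑ}, ‖z‖ₑ ^ p ∂κ) atTop (𝓝 0) := by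
  refine tendsto_setLIntegral_zero hκ.ne ?_
  have hmeas : ∀ k : ℕ, MeasurableSet {z : ℝ | (k : ℝ≥0∞) ≤ ‖z‖ₑ} := fun k =>
    measurableSet_le (by fun_prop) (by fun_prop)
  have := tendsto_measure_iInter_atTop (μ := κ) (fun k => (hmeas k).nullMeasurableSet)
    (fun i j hij z (hz : (j : ℝ≥0∞) ≤ ‖z‖ₑ) => (Nat.cast_le.2 hij).trans hz) ⟨0, measure_ne_top _ _⟩
  have hempty : ⋂ k : ℕ, {z : ℝ | (k : ℝ≥0∞) ≤ ‖z‖ₑ} = ∅ := by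
    ext z
    simp only [Set.mem_iInter, Set.mem_ofPred_eq, Set.mem_empty_iff_false, iff_false, not_forall,
      not_le]
    exact ENNReal.exists_nat_gt enorm_ne_top
  rwa [hempty, measure_empty] at this

lemma exists_pos_measure_le_of_measure_ne_zero {α : Type*} [MeasurableSpace α] {ρ : Measure α}
    {f : α → ℝ} (h : ρ {a | f a ≠ 0} ≠ 0) :
    ∃ δ : ℝ≥0∞, δ ≠ 0 ∧ δ ≠ ∞ ∧ ρ {a | δ ≤ ‖f a‖ₑ} ≠ 0 := by
  by_contra! hcon
  refine h ?_
  have hsub : {a | f a ≠ 0} ⊆ ⋃ k : ℕ, {a | ((k : ℝ≥0∞) + 1)⁻¹ ≤ ‖f a‖ₑ} := by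
    intro a ha
    obtain ⟨k, hk⟩ := ENNReal.exists_inv_nat_lt (a := ‖f a‖ₑ) (by simpa using ha)
    refine Set.mem_iUnion.2 ⟨k, le_trans ?_ hk.le⟩
    exact ENNReal.inv_le_inv.2 le_self_add
  refine measure_mono_null hsub (measure_iUnion_null fun k => hcon _ ?_ ?_)
  · simp
  · simp

/-- If two independent copies agreed a.s., Fubini would give a section on which κ is a point mass.
-/
lemma prod_self_measure_ne_ne_zero [IsProbabilityMeasure κ] (hκ : ∀ c, κ {c} < 1) :
    (κ.prod κ) {q | q.1 - q.2 ≠ 0} ≠ 0 := by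
  intro h
  have hm : MeasurableSet {q : ℝ × ℝ | q.1 - q.2 ≠ 0} :=
    (measurableSet_eq_fun (by fun_prop) measurable_const).compl
  rw [Measure.measure_prod_null hm] at h
  obtain ⟨c, hc⟩ := h.exists
  refine (hκ c).ne ?_
  rw [← prob_compl_eq_zero_iff (measurableSet_singleton c)]
  have hset : ({c} : Set ℝ)ᶜ = Prod.mk c ⁻¹' {q | q.1 - q.2 ≠ 0} := by
    ext z
    simp [sub_eq_zero, eq_comm]
  rw [hset]
  exact hc

end RandomAffineFixedPoint

/-! ### Uniform integrability of the slopes. -/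

section SlopeMoment

variable {Ω : Type*} [MeasurableSpace Ω] {μ : Measure Ω} [IsProbabilityMeasure μ]
  {κ : Measure ℝ} [IsProbabilityMeasure κ] {X Y : ℕ → Ω → ℝ} {p : ℝ}

/-- If a nondegenerate law with finite `p`-th moment is invariant under random affine maps whose
slopes vanish in probability, then the slopes eventually have small `p`-th moment. -/
lemma exists_lintegral_slope_lt_one (hp : 0 < p)
    (hX : ∀ n, Measurable (X n)) (hY : ∀ n, Measurable (Y n))
    (hfix : ∀ n, (μ.prod κ).map (fun q => X n q.1 + Y n q.1 * q.2) = κ)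
    (hκ : ∀ c, κ {c} < 1) (hmom : ∫⁻ z, ‖z‖ₑ ^ p ∂κ < ∞)
    (hlim : ∀ η : ℝ≥0∞, η ≠ 0 → η ≠ ∞ → Tendsto (fun n => μ {ω | η ≤ ‖Y n ω‖ₑ}) atTop (𝓝 0)) :
    ∃ n, ∫⁻ ω, ‖Y n ω‖ₑ ^ p ∂μ < 1 := by
  obtain ⟨δ, hδ0, hδ, hpos⟩ :=
    exists_pos_measure_le_of_measure_ne_zero (prod_self_measure_ne_ne_zero hκ)
  set c := δ ^ p * (κ.prod κ) {q | δ ≤ ‖q.1 - q.2‖ₑ}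
  have hδp0 : δ ^ p ≠ 0 := by simp [ENNReal.rpow_eq_zero_iff, hδ0, hδ]
  have hδp : δ ^ p ≠ ∞ := ENNReal.rpow_ne_top_of_nonneg hp.le hδ
  have hc0 : c ≠ 0 := mul_ne_zero hδp0 hpos
  have hc : c ≠ ∞ := ENNReal.mul_ne_top hδp (measure_ne_top _ _)
  have h4 : (0 : ℝ≥0∞) < 4⁻¹ := by simp
  have h2p : (2 : ℝ≥0∞) ^ p ≠ ∞ := ENNReal.rpow_ne_top_of_nonneg hp.le (by simp)
  have htail : Tendsto (fun k : ℕ => 2 ^ p * (2 * ∫⁻ z in {z : ℝ | (k : ℝ≥0∞) ≤ ‖z‖ₑ},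
      ‖z‖ₑ ^ p ∂κ) / c) atTop (𝓝 0) := by
    have h := ENNReal.Tendsto.div_const (ENNReal.Tendsto.const_mul (a := 2 ^ p)
      (ENNReal.Tendsto.const_mul (a := 2) (tendsto_setLIntegral_enorm_rpow_tail hmom)
        (Or.inr (by simp))) (Or.inr h2p)) (b := c) (Or.inr hc0)
    simpa using h
  -- `K` precedes `n`: the tail bound is uniform in `n`. The ranges of ‖Y‖ up to η, from η to T, and
  -- beyond T contribute at most 1/4 each.
  obtain ⟨K, hK⟩ := (htail.eventually_lt_const h4).exists
  set T : ℝ≥0∞ := 2 * K / δ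
  have hT : T ≠ ∞ := ENNReal.div_ne_top (ENNReal.mul_ne_top (by simp) (by simp)) hδ0
  have hTp : T ^ p ≠ ∞ := ENNReal.rpow_ne_top_of_nonneg hp.le hT
  set η : ℝ≥0∞ := (4⁻¹) ^ p⁻¹ with hη_def
  have hη0 : η ≠ 0 := by simp [hη_def, ENNReal.rpow_eq_zero_iff]
  have hη : η ≠ ∞ := ENNReal.rpow_ne_top_of_nonneg (by positivity) (by simp)
  have hηp : η ^ p = 4⁻¹ := ENNReal.rpow_inv_rpow hp.ne' _
  have hmid : Tendsto (fun n => T ^ p * μ {ω | η ≤ ‖Y n ω‖ₑ}) atTop (𝓝 0) := by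
    simpa using ENNReal.Tendsto.const_mul (hlim η hη0 hη) (Or.inr hTp)
  obtain ⟨n, hn⟩ := (hmid.eventually_lt_const h4).exists
  refine ⟨n, ?_⟩
  set S : Set Ω := {ω | 2 * K ≤ δ * ‖Y n ω‖ₑ}
  have hS : MeasurableSet S := measurableSet_le (by fun_prop) (by fun_prop)
  set E : Set Ω := {ω | η ≤ ‖Y n ω‖ₑ}
  have hE : MeasurableSet E := measurableSet_le (by fun_prop) (by fun_prop)
  have hbig : ∫⁻ ω in S, ‖Y n ω‖ₑ ^ p ∂μ < 4⁻¹ := by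
    refine lt_of_le_of_lt ?_ hK
    rw [ENNReal.le_div_iff_mul_le (Or.inl hc0) (Or.inl hc)]
    exact setLIntegral_slope_mul_le hp (hX n) (hY n) (hfix n) K δ
  calc ∫⁻ ω, ‖Y n ω‖ₑ ^ p ∂μ
      ≤ ∫⁻ ω, (η ^ p + (E.indicator (fun _ => T ^ p) ω +
          S.indicator (fun ω => ‖Y n ω‖ₑ ^ p) ω)) ∂μ := by
        refine lintegral_mono fun ω => ?_
        by_cases hω : ω ∈ S
        · simp only [Set.indicator_of_mem hω]
          exact le_add_self.trans le_add_self
        · by_cases hωE : ω ∈ E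
          · simp only [Set.indicator_of_mem hωE]
            refine le_trans (ENNReal.rpow_le_rpow ?_ hp.le) (le_self_add.trans le_add_self)
            rw [ENNReal.le_div_iff_mul_le (Or.inl hδ0) (Or.inl hδ), mul_comm]
            exact (not_le.1 hω).le
          · exact (ENNReal.rpow_le_rpow (not_le.1 hωE).le hp.le).trans le_self_add
    _ = 4⁻¹ + (T ^ p * μ E + ∫⁻ ω in S, ‖Y n ω‖ₑ ^ p ∂μ) := by
        rw [lintegral_add_left measurable_const,
          lintegral_add_left (measurable_const.indicator hE), lintegral_indicator hE,
          lintegral_indicator hS, setLIntegral_const, hηp]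
        simp
    _ < 4⁻¹ + (4⁻¹ + 4⁻¹) :=
        ENNReal.add_lt_add_left (by simp) (ENNReal.add_lt_add hn hbig)
    _ ≤ 1 := by
        have : (4⁻¹ : ℝ≥0∞) + (4⁻¹ + 4⁻¹) = 3 / 4 := by
          rw [div_eq_mul_inv]; ring
        rw [this]
        exact ENNReal.div_le_of_le_mul (by norm_num)

end SlopeMoment

/-! ### The restarted perpetuity. -/

section TailLimit

variable {Ω : Type*}

/-- The upper limit of the perpetuity series started at time `n`. -/
noncomputable def tailLimit (M Q : ℕ → Ω → ℝ) (n : ℕ) (ω : Ω) : ℝ :=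
  limsup (fun k => partialSum (fun j => M (n + j)) (fun j => Q (n + j)) k ω) atTop

lemma enorm_prodM_rpow {M : ℕ → Ω → ℝ} {p : ℝ} (hp : 0 < p) (n : ℕ) (ω : Ω) :
    ‖prodM M n ω‖ₑ ^ p = ∏ i ∈ Finset.range n, ‖M i ω‖ₑ ^ p := by
  rw [ENNReal.prod_rpow_of_nonneg hp.le]
  congr 1
  induction n with
  | zero => simp [prodM]
  | succ n ih =>
    rw [Finset.prod_range_succ, ← ih, prodM, Finset.prod_range_succ, enorm_mul]
    rfl

/-- Dividing by the nonzero product shows that the restarted series converges, so its limsup is its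
limit. -/
lemma eq_partialSum_add_tailLimit {M Q : ℕ → Ω → ℝ} {ω : Ω} {z : ℝ} {n : ℕ} (hM : ∀ i, M i ω ≠ 0)
    (hz : Tendsto (fun k => partialSum M Q k ω) atTop (𝓝 z)) :
    z = partialSum M Q n ω + prodM M n ω * tailLimit M Q n ω := by
  have hne : prodM M n ω ≠ 0 := Finset.prod_ne_zero_iff.2 fun i _ => hM i
  have h1 : Tendsto (fun k => (partialSum M Q (n + k) ω - partialSum M Q n ω) / prodM M n ω)
      atTop (𝓝 ((z - partialSum M Q n ω) / prodM M n ω)) := by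
    have h2 : Tendsto (fun k => partialSum M Q (n + k) ω) atTop (𝓝 z) := by
      simpa only [add_comm n] using (tendsto_add_atTop_iff_nat n).2 hz
    exact (h2.sub_const _).div_const _
  have h3 : tailLimit M Q n ω = (z - partialSum M Q n ω) / prodM M n ω := by
    refine Tendsto.limsup_eq (h1.congr fun k => ?_)
    rw [partialSum_add]
    field_simp
    ring
  rw [h3]
  field_simp
  ring

variable [mΩ : MeasurableSpace Ω] {μ : Measure Ω} {M Q : ℕ → Ω → ℝ}

lemma measurable_tailLimit {n : ℕ} (hM : ∀ i, n ≤ i → Measurable (M i))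
    (hQ : ∀ i, n ≤ i → Measurable (Q i)) : Measurable (tailLimit M Q n) := by
  unfold tailLimit
  exact Measurable.limsup fun k => measurable_partialSum
    (fun j _ => hM _ (Nat.le_add_right n j)) (fun j _ => hQ _ (Nat.le_add_right n j))

/-- The first `n` steps are independent of the perpetuity started at time `n`. -/
lemma indepFun_tailLimit (hM : ∀ n, Measurable (M n)) (hQ : ∀ n, Measurable (Q n))
    (hindep : iIndepFun (fun n ω => (M n ω, Q n ω)) μ) (n : ℕ) :
    IndepFun (fun ω => (partialSum M Q n ω, prodM M n ω)) (tailLimit M Q n) μ := by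
  set m : ℕ → MeasurableSpace Ω := fun i =>
    MeasurableSpace.comap (fun ω => (M i ω, Q i ω)) inferInstance with hm
  have hdisj : Disjoint (Set.Iio n) (Set.Ici n) := by
    rw [Set.disjoint_left]
    exact fun i (hi : i < n) (hi' : n ≤ i) => not_le.2 hi hi'
  have hI := indep_iSup_of_disjoint (m := m)
    (fun i => ((hM i).prodMk (hQ i)).comap_le) ((iIndepFun_iff_iIndep _ _ _).1 hindep) hdisj
  have hpair : ∀ {S : Set ℕ} {i : ℕ}, i ∈ S →
      Measurable[⨆ i ∈ S, m i] fun ω => (M i ω, Q i ω) := fun hi =>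
    (comap_measurable _).mono (le_biSup m hi) le_rfl
  have hMi : ∀ {S : Set ℕ} {i : ℕ}, i ∈ S → Measurable[⨆ i ∈ S, m i] (M i) := fun hi =>
    measurable_fst.comp (hpair hi)
  have hQi : ∀ {S : Set ℕ} {i : ℕ}, i ∈ S → Measurable[⨆ i ∈ S, m i] (Q i) := fun hi =>
    measurable_snd.comp (hpair hi)
  refine (IndepFun_iff_Indep _ _ _).2 (indep_of_indep_of_le_left
    (indep_of_indep_of_le_right hI (Measurable.comap_le ?_)) (Measurable.comap_le ?_))
  -- A limsup is measurable for the σ-algebra of the coordinates from `n` on, with no null-set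
  -- modification.
  · exact @measurable_tailLimit _ (⨆ i ∈ Set.Ici n, m i) M Q n (fun i hi => hMi hi)
      (fun i hi => hQi hi)
  · exact Measurable.prodMk
      (@measurable_partialSum _ M Q (⨆ i ∈ Set.Iio n, m i) n (fun i hi => hMi hi)
        (fun i hi => hQi hi))
      (@measurable_prodM _ M (⨆ i ∈ Set.Iio n, m i) n (fun i hi => hMi hi))

/-- Shifted sequences have the same law on path space, and the tail limit is one measurable
functional of the path. -/
lemma identDistrib_tailLimit {Ω' : Type*} [MeasurableSpace Ω'] {ν : Measure Ω'} {M' Q' : Ω' → ℝ}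
    (hindep : iIndepFun (fun n ω => (M n ω, Q n ω)) μ)
    (hident : ∀ n, IdentDistrib (fun ω => (M n ω, Q n ω)) (fun ω => (M' ω, Q' ω)) μ ν) (n : ℕ) :
    IdentDistrib (tailLimit M Q n) (tailLimit M Q 0) μ μ := by
  have hseq : ∀ k, iIndepFun (fun j ω => (M (k + j) ω, Q (k + j) ω)) μ := fun k =>
    hindep.precomp (add_right_injective k)
  have h := IdentDistrib.pi (fun j => (hident (n + j)).trans (hident (0 + j)).symm)
    (hseq n) (hseq 0)
  have h' := h.comp (measurable_tailLimit (M := fun i (x : ℕ → ℝ × ℝ) => (x i).1)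
    (Q := fun i (x : ℕ → ℝ × ℝ) => (x i).2) (n := 0) (by fun_prop) (by fun_prop))
  unfold tailLimit
  simpa [tailLimit, partialSum, prodM, Function.comp_def] using h'

end TailLimit

/-! ### Moments and the implications. -/

section Moments

variable {Ω Ω' : Type*} [MeasurableSpace Ω] [MeasurableSpace Ω'] {μ : Measure Ω} {ν : Measure Ω'}
  {M Q : ℕ → Ω → ℝ} {M' Q' : Ω' → ℝ} {p : ℝ}

lemma lintegral_enorm_fst_rpow
    (hident : ∀ n, IdentDistrib (fun ω => (M n ω, Q n ω)) (fun ω => (M' ω, Q' ω)) μ ν) (n : ℕ) :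
    ∫⁻ ω, ‖M n ω‖ₑ ^ p ∂μ = ∫⁻ ω, ‖M' ω‖ₑ ^ p ∂ν :=
  ((hident n).comp (u := fun x : ℝ × ℝ => ‖x.1‖ₑ ^ p) (by fun_prop)).lintegral_eq

lemma lintegral_enorm_snd_rpow
    (hident : ∀ n, IdentDistrib (fun ω => (M n ω, Q n ω)) (fun ω => (M' ω, Q' ω)) μ ν) (n : ℕ) :
    ∫⁻ ω, ‖Q n ω‖ₑ ^ p ∂μ = ∫⁻ ω, ‖Q' ω‖ₑ ^ p ∂ν :=
  ((hident n).comp (u := fun x : ℝ × ℝ => ‖x.2‖ₑ ^ p) (by fun_prop)).lintegral_eq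

lemma lintegral_enorm_prodM_rpow (hp : 0 < p) (hM : ∀ n, Measurable (M n))
    (hindep : iIndepFun (fun n ω => (M n ω, Q n ω)) μ)
    (hident : ∀ n, IdentDistrib (fun ω => (M n ω, Q n ω)) (fun ω => (M' ω, Q' ω)) μ ν) (n : ℕ) :
    ∫⁻ ω, ‖prodM M n ω‖ₑ ^ p ∂μ = (∫⁻ ω, ‖M' ω‖ₑ ^ p ∂ν) ^ n := by
  have hu : Measurable fun x : ℝ × ℝ => ‖x.1‖ₑ ^ p := by fun_prop
  have h := lintegral_prod_eq_prod_lintegral_of_indepFun (Finset.range n)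
    (fun i ω => ‖M i ω‖ₑ ^ p) (hindep.comp (fun _ x => ‖x.1‖ₑ ^ p) fun _ => hu)
    (fun i => by fun_prop)
  simp_rw [enorm_prodM_rpow hp, h, lintegral_enorm_fst_rpow hident]
  simp

lemma lintegral_enorm_prodM_mul_rpow (hp : 0 < p)
    (hM : ∀ n, Measurable (M n)) (hQ : ∀ n, Measurable (Q n))
    (hindep : iIndepFun (fun n ω => (M n ω, Q n ω)) μ)
    (hident : ∀ n, IdentDistrib (fun ω => (M n ω, Q n ω)) (fun ω => (M' ω, Q' ω)) μ ν) (n : ℕ) :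
    ∫⁻ ω, ‖prodM M n ω * Q n ω‖ₑ ^ p ∂μ =
      (∫⁻ ω, ‖M' ω‖ₑ ^ p ∂ν) ^ n * ∫⁻ ω, ‖Q' ω‖ₑ ^ p ∂ν := by
  have hI : IndepFun (prodM M n) (Q n) μ := by
    have h := (hindep.indepFun_finset (Finset.range n) {n} (by simp)
      fun i => (hM i).prodMk (hQ i)).comp
      (φ := fun x : Finset.range n → ℝ × ℝ => ∏ i, (x i).1)
      (ψ := fun x : ({n} : Finset ℕ) → ℝ × ℝ => (x ⟨n, by simp⟩).2) (by fun_prop) (by fun_prop)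
    convert h using 1
    · ext ω
      exact (Finset.prod_coe_sort (Finset.range n) fun i => M i ω).symm
    · rfl
  have hP : Measurable (prodM M n) := measurable_prodM fun i _ => hM i
  have hu : Measurable fun x : ℝ => ‖x‖ₑ ^ p := by fun_prop
  simp_rw [enorm_mul, ENNReal.mul_rpow_of_nonneg _ _ hp.le]
  rw [← lintegral_enorm_prodM_rpow hp hM hindep hident, ← lintegral_enorm_snd_rpow hident n]
  exact lintegral_mul_eq_lintegral_mul_lintegral_of_indepFun'' (hu.comp hP).aemeasurable
    (hu.comp (hQ n)).aemeasurable (hI.comp hu hu)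

/-- The `p`-th moment of the absolute perpetuity series is finite if the multipliers contract in
`p`-th mean. -/
lemma lintegral_absSeries_rpow_lt_top (hp : 0 < p)
    (hM : ∀ n, Measurable (M n)) (hQ : ∀ n, Measurable (Q n))
    (hindep : iIndepFun (fun n ω => (M n ω, Q n ω)) μ)
    (hident : ∀ n, IdentDistrib (fun ω => (M n ω, Q n ω)) (fun ω => (M' ω, Q' ω)) μ ν)
    (hM1 : ∫⁻ ω, ‖M' ω‖ₑ ^ p ∂ν < 1) (hQ1 : ∫⁻ ω, ‖Q' ω‖ₑ ^ p ∂ν < ∞) :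
    ∫⁻ ω, absSeries M Q ω ^ p ∂μ < ∞ := by
  -- t < 1 keeps the constant finite; t > E|M|^p makes the weighted series converge.
  obtain ⟨t, hrt, ht1⟩ := exists_between hM1
  have ht0 : t ≠ 0 := (bot_le.trans_lt hrt).ne'
  have ht : t ≠ ∞ := (ht1.trans ENNReal.one_lt_top).ne
  have hP : ∀ n, Measurable (prodM M n) := fun n => measurable_prodM fun i _ => hM i
  have hterm : ∀ n, Measurable fun ω => ‖prodM M n ω * Q n ω‖ₑ ^ p * (t⁻¹) ^ n := fun n => by
    have := hP n
    have := hQ n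
    fun_prop
  have hC : ((1 - t ^ p⁻¹)⁻¹) ^ p ≠ ∞ := by
    refine ENNReal.rpow_ne_top_of_nonneg hp.le (ENNReal.inv_ne_top.2 ?_)
    exact (tsub_pos_of_lt (ENNReal.rpow_lt_one ht1 (by positivity))).ne'
  calc ∫⁻ ω, absSeries M Q ω ^ p ∂μ
      ≤ ∫⁻ ω, ((1 - t ^ p⁻¹)⁻¹) ^ p * ∑' n, ‖prodM M n ω * Q n ω‖ₑ ^ p * (t⁻¹) ^ n ∂μ :=
        lintegral_mono fun ω => tsum_rpow_le_weighted hp ht0 ht _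
    _ = ((1 - t ^ p⁻¹)⁻¹) ^ p * ∑' n, ((∫⁻ ω, ‖M' ω‖ₑ ^ p ∂ν) * t⁻¹) ^ n *
          ∫⁻ ω, ‖Q' ω‖ₑ ^ p ∂ν := by
        rw [lintegral_const_mul _ (Measurable.tsum hterm),
          lintegral_tsum fun n => (hterm n).aemeasurable]
        congr 2 with n
        have hm : Measurable fun ω => ‖prodM M n ω * Q n ω‖ₑ ^ p := by
          have := hP n
          have := hQ n
          fun_prop
        rw [lintegral_mul_const _ hm, lintegral_enorm_prodM_mul_rpow hp hM hQ hindep hident,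
          mul_pow]
        ring
    _ < ∞ := by
        rw [ENNReal.tsum_mul_right, ENNReal.tsum_geometric]
        refine ENNReal.mul_lt_top hC.lt_top (ENNReal.mul_lt_top (lt_top_iff_ne_top.2 ?_) hQ1)
        refine ENNReal.inv_ne_top.2 (tsub_pos_of_lt ?_).ne'
        rw [← div_eq_mul_inv]
        exact ENNReal.div_lt_of_lt_mul (by simpa using hrt)

lemma exists_isPerpetuity_of_lintegral_absSeries (hp : 0 < p)
    (hM : ∀ n, Measurable (M n)) (hQ : ∀ n, Measurable (Q n))
    (h : ∫⁻ ω, absSeries M Q ω ^ p ∂μ < ∞) :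
    ∃ Z : Ω → ℝ, IsPerpetuity μ M Q Z ∧ ∫⁻ ω, ‖Z ω‖ₑ ^ p ∂μ < ∞ := by
  have hmeas : Measurable (absSeries M Q) := by
    unfold absSeries
    exact Measurable.tsum fun n =>
      ((measurable_prodM fun i _ => hM i).mul (hQ n)).enorm
  have hfin : ∀ᵐ ω ∂μ, absSeries M Q ω < ∞ := by
    filter_upwards [ae_lt_top (hmeas.pow_const p) h.ne] with ω hω
    exact (ENNReal.rpow_lt_top_iff_of_pos hp).1 hω
  refine ⟨fun ω => ∑' n, prodM M n ω * Q n ω, ?_, ?_⟩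
  · filter_upwards [hfin] with ω hω
    exact (Summable.of_enorm hω.ne).hasSum.tendsto_sum_nat
  · refine lt_of_le_of_lt (lintegral_mono fun ω => ?_) h
    exact ENNReal.rpow_le_rpow enorm_tsum_le_tsum_enorm hp.le

lemma moments_of_isPerpetuity [IsProbabilityMeasure μ] [IsProbabilityMeasure ν] (hp : 0 < p)
    (hM : ∀ n, Measurable (M n)) (hQ : ∀ n, Measurable (Q n))
    (hindep : iIndepFun (fun n ω => (M n ω, Q n ω)) μ)
    (hident : ∀ n, IdentDistrib (fun ω => (M n ω, Q n ω)) (fun ω => (M' ω, Q' ω)) μ ν)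
    (hM0 : ν {ω | M' ω = 0} = 0) (hdeg : ∀ c : ℝ, ν {ω | Q' ω + M' ω * c = c} < 1)
    {Z : Ω → ℝ} (hZ : IsPerpetuity μ M Q Z) (hmom : ∫⁻ ω, ‖Z ω‖ₑ ^ p ∂μ < ∞) :
    (∫⁻ ω, ‖M' ω‖ₑ ^ p ∂ν < 1) ∧ (∫⁻ ω, ‖Q' ω‖ₑ ^ p ∂ν < ∞) := by
  have hu : Measurable fun x : ℝ => ‖x‖ₑ ^ p := by fun_prop
  have hne : ∀ᵐ ω ∂μ, ∀ i, M i ω ≠ 0 := by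
    refine ae_all_iff.2 fun i => ?_
    rw [ae_iff]
    simp only [ne_eq, not_not]
    rw [← hM0]
    exact (hident i).measure_mem_eq (s := {x | x.1 = 0})
      (measurableSet_eq_fun measurable_fst measurable_const)
  have hX : ∀ n, Measurable (partialSum M Q n) := fun n =>
    measurable_partialSum (fun i _ => hM i) (fun i _ => hQ i)
  have hY : ∀ n, Measurable (prodM M n) := fun n => measurable_prodM fun i _ => hM i
  have hW : ∀ n, Measurable (tailLimit M Q n) := fun n =>
    measurable_tailLimit (fun i _ => hM i) (fun i _ => hQ i)
  have hdecomp : ∀ n, Z =ᵐ[μ] fun ω =>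
      partialSum M Q n ω + prodM M n ω * tailLimit M Q n ω := fun n => by
    filter_upwards [hne, hZ] with ω h1 h2 using eq_partialSum_add_tailLimit h1 h2
  -- `Z` need not be measurable, so its measurable version is used.
  set κ : Measure ℝ := μ.map (tailLimit M Q 0) with hκ_def
  have : IsProbabilityMeasure κ := Measure.isProbabilityMeasure_map (hW 0).aemeasurable
  have hκn : ∀ n, μ.map (tailLimit M Q n) = κ := fun n =>
    (identDistrib_tailLimit hindep hident n).map_eq
  have hZ0 : Z =ᵐ[μ] tailLimit M Q 0 := by simpa [partialSum, prodM] using hdecomp 0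
  have hI := indepFun_tailLimit hM hQ hindep
  have hfix : ∀ n, (μ.prod κ).map (fun q => partialSum M Q n q.1 + prodM M n q.1 * q.2) = κ := by
    intro n
    have h1 := (indepFun_iff_map_prod_eq_prod_map_map ((hX n).prodMk (hY n)).aemeasurable
      (hW n).aemeasurable).1 (hI n)
    have h2 : (μ.prod κ).map
        (Prod.map (fun ω => (partialSum M Q n ω, prodM M n ω)) (id : ℝ → ℝ)) =
        μ.map (fun ω => ((partialSum M Q n ω, prodM M n ω), tailLimit M Q n ω)) := by
      rw [h1, hκn, ← Measure.map_prod_map _ _ ((hX n).prodMk (hY n)) measurable_id, Measure.map_id]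
    have hf : Measurable fun x : (ℝ × ℝ) × ℝ => x.1.1 + x.1.2 * x.2 := by fun_prop
    have h3 := congrArg (Measure.map fun x : (ℝ × ℝ) × ℝ => x.1.1 + x.1.2 * x.2) h2
    rw [Measure.map_map hf (((hX n).prodMk (hY n)).prodMap measurable_id),
      Measure.map_map hf (((hX n).prodMk (hY n)).prodMk (hW n))] at h3
    refine Eq.trans h3 (Measure.map_congr ?_)
    exact (hdecomp n).symm.trans hZ0
  have hX1 : ∀ ω, partialSum M Q 1 ω = Q 0 ω := fun ω => by simp [partialSum, prodM]
  have hY1 : ∀ ω, prodM M 1 ω = M 0 ω := fun ω => by simp [prodM]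
  have hκmom : ∫⁻ z, ‖z‖ₑ ^ p ∂κ < ∞ := by
    rw [hκ_def, lintegral_map hu (hW 0)]
    refine lt_of_eq_of_lt (lintegral_congr_ae ?_) hmom
    filter_upwards [hZ0] with ω hω
    rw [hω]
  -- A point mass at `c` would force Q + Mc = c a.s.
  have hκdeg : ∀ c, κ {c} < 1 := by
    intro c
    refine lt_of_le_of_ne prob_le_one fun hc => ?_
    have hZc : ∀ n, ∀ᵐ ω ∂μ, tailLimit M Q n ω = c := fun n => by
      rw [← hκn n, Measure.map_apply (hW n) (measurableSet_singleton c)] at hc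
      exact (mem_ae_iff_prob_eq_one (hW n (measurableSet_singleton c))).2 hc
    have hm : MeasurableSet {x : ℝ × ℝ | x.2 + x.1 * c = c} :=
      measurableSet_eq_fun (by fun_prop) measurable_const
    refine (hdeg c).ne ?_
    refine ((hident 0).measure_mem_eq hm).symm.trans ?_
    refine (mem_ae_iff_prob_eq_one (((hM 0).prodMk (hQ 0)) hm)).1 ?_
    filter_upwards [hZc 0, hZc 1, hZ0, hdecomp 1] with ω h0 h1 h2 h3
    rw [hX1, hY1, h1, h2, h0] at h3
    exact h3.symm
  have hlim : ∀ η : ℝ≥0∞, η ≠ 0 → η ≠ ∞ →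
      Tendsto (fun n => μ {ω | η ≤ ‖prodM M n ω‖ₑ}) atTop (𝓝 0) := by
    intro η hη0 hη
    have hκ0 : κ {z | z ≠ 0} ≠ 0 := fun h => (hκdeg 0).ne
      ((prob_compl_eq_zero_iff (measurableSet_singleton 0)).1 h)
    obtain ⟨δ, hδ0, hδ, hδpos⟩ := exists_pos_measure_le_of_measure_ne_zero hκ0
    have hconv := tendstoInMeasure_of_tendsto_ae (fun n => (hX n).aestronglyMeasurable) hZ
      (η * δ) (pos_iff_ne_zero.2 (mul_ne_zero hη0 hδ0))
    -- By independence, P(|Π_n| ≥ η) κ(|z| ≥ δ) ≤ P(|Z - Z_n| ≥ ηδ).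
    have hbound : ∀ n, μ {ω | η ≤ ‖prodM M n ω‖ₑ} ≤
        μ {ω | η * δ ≤ edist (partialSum M Q n ω) (Z ω)} / κ {z | δ ≤ ‖z‖ₑ} := by
      intro n
      rw [ENNReal.le_div_iff_mul_le (Or.inl hδpos) (Or.inl (measure_ne_top _ _)), ← hκn n,
        Measure.map_apply (hW n) (measurableSet_le measurable_const measurable_enorm)]
      have hmul := (hI n).measure_inter_preimage_eq_mul {x : ℝ × ℝ | η ≤ ‖x.2‖ₑ} {z : ℝ | δ ≤ ‖z‖ₑ}
        (measurableSet_le measurable_const (by fun_prop))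
        (measurableSet_le measurable_const measurable_enorm)
      refine le_trans hmul.ge (measure_mono_ae ?_)
      filter_upwards [hdecomp n] with ω hω
      rintro ⟨h1 : η ≤ ‖prodM M n ω‖ₑ, h2 : δ ≤ ‖tailLimit M Q n ω‖ₑ⟩
      change η * δ ≤ edist (partialSum M Q n ω) (Z ω)
      rw [hω, edist_comm, edist_eq_enorm_sub, add_sub_cancel_left, enorm_mul]
      gcongr
    have h0 := ENNReal.Tendsto.div_const hconv (b := κ {z | δ ≤ ‖z‖ₑ}) (Or.inr hδpos)
    rw [ENNReal.zero_div] at h0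
    exact tendsto_of_tendsto_of_tendsto_of_le_of_le tendsto_const_nhds h0 (fun _ => bot_le) hbound
  obtain ⟨n, hn⟩ := exists_lintegral_slope_lt_one hp hX hY hfix hκdeg hκmom hlim
  rw [lintegral_enorm_prodM_rpow hp hM hindep hident] at hn
  have hM1 : ∫⁻ ω, ‖M' ω‖ₑ ^ p ∂ν < 1 := by
    by_contra! h
    exact absurd (one_le_pow_of_one_le' h n) (not_le.2 hn)
  refine ⟨hM1, ?_⟩
  have hfub : ∫⁻ z, ∫⁻ ω, ‖partialSum M Q 1 ω + prodM M 1 ω * z‖ₑ ^ p ∂μ ∂κ < ∞ := by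
    have hjoint : Measurable fun q : Ω × ℝ => ‖partialSum M Q 1 q.1 + prodM M 1 q.1 * q.2‖ₑ ^ p := by
      have := hX 1
      have := hY 1
      fun_prop
    rw [← lintegral_lintegral_swap hjoint.aemeasurable,
      lintegral_eq_of_map_affine (hX 1) (hY 1) (hfix 1) hu]
    exact hκmom
  -- Fubini supplies a deterministic `z`; then Q = (Q + Mz) - Mz is a difference of terms with
  -- finite `p`-th moment.
  have hex : ∃ z, ∫⁻ ω, ‖Q 0 ω + M 0 ω * z‖ₑ ^ p ∂μ < ∞ := by
    simp only [hX1, hY1] at hfub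
    have hjoint : Measurable fun q : ℝ × Ω => ‖Q 0 q.2 + M 0 q.2 * q.1‖ₑ ^ p := by
      have := hQ 0
      have := hM 0
      fun_prop
    exact (ae_lt_top hjoint.lintegral_prod_right' hfub.ne).exists
  obtain ⟨z, hz⟩ := hex
  have hM10 : ∫⁻ ω, ‖M 0 ω‖ₑ ^ p ∂μ < 1 := by
    rwa [lintegral_enorm_fst_rpow hident 0]
  rw [← lintegral_enorm_snd_rpow hident 0]
  have hsum : Measurable fun ω => ‖Q 0 ω + M 0 ω * z‖ₑ ^ p := by
    have := hQ 0
    have := hM 0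
    fun_prop
  have hpt : ∀ ω, ‖Q 0 ω‖ₑ ^ p ≤
      2 ^ p * (‖Q 0 ω + M 0 ω * z‖ₑ ^ p + ‖M 0 ω‖ₑ ^ p * ‖z‖ₑ ^ p) := by
    intro ω
    set a := ‖Q 0 ω + M 0 ω * z‖ₑ
    set b := ‖M 0 ω‖ₑ * ‖z‖ₑ with hb
    have h1 : ‖Q 0 ω‖ₑ ≤ a + b := by
      rw [hb, ← enorm_mul]
      calc ‖Q 0 ω‖ₑ = ‖(Q 0 ω + M 0 ω * z) - M 0 ω * z‖ₑ := by rw [add_sub_cancel_right]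
        _ ≤ _ := enorm_sub_le
    have h2 : a + b ≤ 2 * max a b := by
      rw [two_mul]
      exact add_le_add (le_max_left _ _) (le_max_right _ _)
    calc ‖Q 0 ω‖ₑ ^ p ≤ (2 * max a b) ^ p := ENNReal.rpow_le_rpow (h1.trans h2) hp.le
      _ = 2 ^ p * max (a ^ p) (b ^ p) := by
          rw [ENNReal.mul_rpow_of_nonneg _ _ hp.le,
            (ENNReal.monotone_rpow_of_nonneg hp.le).map_max]
      _ ≤ 2 ^ p * (a ^ p + b ^ p) := by
          gcongr
          exact max_le le_self_add le_add_self
      _ = _ := by rw [hb, ENNReal.mul_rpow_of_nonneg _ _ hp.le]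
  calc ∫⁻ ω, ‖Q 0 ω‖ₑ ^ p ∂μ
      ≤ ∫⁻ ω, 2 ^ p * (‖Q 0 ω + M 0 ω * z‖ₑ ^ p + ‖M 0 ω‖ₑ ^ p * ‖z‖ₑ ^ p) ∂μ :=
        lintegral_mono hpt
    _ = 2 ^ p * (∫⁻ ω, ‖Q 0 ω + M 0 ω * z‖ₑ ^ p ∂μ +
          (∫⁻ ω, ‖M 0 ω‖ₑ ^ p ∂μ) * ‖z‖ₑ ^ p) := by
        rw [lintegral_const_mul' _ _ (ENNReal.rpow_ne_top_of_nonneg hp.le (by simp)),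
          lintegral_add_left hsum,
          lintegral_mul_const' _ _ (ENNReal.rpow_ne_top_of_nonneg hp.le enorm_ne_top)]
    _ < ∞ := by
        refine ENNReal.mul_lt_top (ENNReal.rpow_lt_top_of_nonneg hp.le (by simp))
          (ENNReal.add_lt_top.2 ⟨hz, ENNReal.mul_lt_top (hM10.trans ENNReal.one_lt_top)
            (ENNReal.rpow_lt_top_of_nonneg hp.le enorm_ne_top)⟩)

end Moments

end Perpetuity

theorem theorem2 {Ω Ω' : Type*} [MeasurableSpace Ω] [MeasurableSpace Ω']
    (μ : Measure Ω) [IsProbabilityMeasure μ] (ν : Measure Ω') [IsProbabilityMeasure ν]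
    -- the i.i.d. sequence of pairs, indexed from `0`, and its generic copy
    (M Q : ℕ → Ω → ℝ) (M' Q' : Ω' → ℝ)
    (hM : ∀ n, Measurable (M n)) (hQ : ∀ n, Measurable (Q n))
    (hindep : iIndepFun (fun n ω => (M n ω, Q n ω)) μ)
    (hident : ∀ n, IdentDistrib (fun ω => (M n ω, Q n ω)) (fun ω => (M' ω, Q' ω)) μ ν)
    (hM0 : ν {ω | M' ω = 0} = 0)
    (hQ0 : ν {ω | Q' ω = 0} < 1)
    (hdeg : ∀ c : ℝ, ν {ω | Q' ω + M' ω * c = c} < 1)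
    (p : ℝ) (hp : 0 < p) :
    List.TFAE
      [(∫⁻ ω, ‖M' ω‖ₑ ^ p ∂ν < 1) ∧ (∫⁻ ω, ‖Q' ω‖ₑ ^ p ∂ν < ∞),
        ∃ Z : Ω → ℝ, Perpetuity.IsPerpetuity μ M Q Z ∧ ∫⁻ ω, ‖Z ω‖ₑ ^ p ∂μ < ∞,
        ∫⁻ ω, Perpetuity.absSeries M Q ω ^ p ∂μ < ∞] := by
  tfae_have 1 → 3 := fun h =>
    Perpetuity.lintegral_absSeries_rpow_lt_top hp hM hQ hindep hident h.1 h.2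
  tfae_have 3 → 2 := Perpetuity.exists_isPerpetuity_of_lintegral_absSeries hp hM hQ
  tfae_have 2 → 1 := fun ⟨_, hZ, hmom⟩ =>
    Perpetuity.moments_of_isPerpetuity hp hM hQ hindep hident hM0 hdeg hZ hmom
  tfae_finish
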